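/- Let $n\ge 1$ and $\mathbf b=(b_1,\dots,b_n)\in\mathbb Z_{>0}^n$, and put $S_i=b_1+\dots+b_i$ for $1\le i\le n$ and $B=S_1+\dots+S_n$. A $\mathbf b$-parking function is a sequence $(\beta_1,\dots,\beta_n)$ of positive integers whose nondecreasing rearrangement $\beta_1'\le\dots\le\beta_n'$ satisfies $\beta_i'\le S_i$ for all $i$. Let $\mathfrak X_n(\mathbf b)\subset\mathbb R^n$ be the convex hull of all $\mathbf b$-parking functions, and let $$\overline{\mathfrak X}_n(\mathbf b)=\Bigl\{\bigl(x_1,\dots,x_n,\;B-\textstyle\sum_{i=1}^n x_i\bigr) : (x_1,\dots,x_n)\in\mathfrak X_n(\mathbf b)\Bigr\}\subset\mathbb R^{n+1}$$ be the lifted $\mathbf b$-parking-function polytope. For nonempty $I\subseteq[n+1]$ let $\triangle_I=\operatorname{conv}\{\mathbf e_i: i\in I\}\subset\mathbb R^{n+1}$. Then $\overline{\mathfrak X}_n(\mathbf b)$ is the signed Minkowski sum $\sum_{\emptyset\ne I\subseteq[n+1]} y_I\,\triangle_I$, where $$y_I=\begin{cases}1 & \text{if } n+1\notin I \text{ and }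 |I|=1,\\ 0 & \text{if } I=\{n+1\},\text{ or if } n+1\notin I\text{ and }|I|\ge 2,\\ b_1-1 & \text{if } n+1\in I\text{ and }|I|=2,\\ \displaystyle\sum_{j=0}^{|I|-3}(-1)^{|I|+j-1}\binom{|I|-3}{j}\,b_{j+2} & \text{if } n+1\in I\text{ and }|I|\ge 3.\end{cases}$$ Here some $y_I$ may be negative, and the statement that a polytope $P$ is the signed Minkowski sum $\sum_I y_I\triangle_I$ means that $$P+\sum_{I:\,y_I<0}(-y_I)\,\triangle_I=\sum_{I:\,y_I>0}y_I\,\triangle_I$$ as Minkowski sums of sets. -/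

import Mathlib

open scoped Pointwise

/-- `S_i = b_1 + ⋯ + b_i` (with `i : Fin n` standing for the 1-based index `i + 1`). -/
def partialSum {n : ℕ} (b : Fin n → ℕ) (i : Fin n) : ℕ :=
  ∑ j ∈ Finset.Iic i, b j

/-- `β` is a `b`-parking function: its entries are positive, and the `i`-th entry of its
nondecreasing rearrangement `β ∘ Tuple.sort β` is at most `b_1 + ⋯ + b_i`. -/
def IsParkingFunction {n : ℕ} (b β : Fin n → ℕ) : Prop :=
  (∀ i, 0 < β i) ∧ ∀ i, (β ∘ Tuple.sort β) i ≤ partialSum b i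

/-- The `b`-parking-function polytope: the convex hull in `ℝⁿ` of all `b`-parking functions. -/
def parkingPolytope {n : ℕ} (b : Fin n → ℕ) : Set (Fin n → ℝ) :=
  convexHull ℝ ((fun (β : Fin n → ℕ) (i : Fin n) => (β i : ℝ)) '' {β | IsParkingFunction b β})

/-- The map `(x_1, …, x_n) ↦ (x_1, …, x_n, B - ∑ x_i)`, where `B = S_1 + ⋯ + S_n`. -/
def liftMap {n : ℕ} (b : Fin n → ℕ) (x : Fin n → ℝ) : Fin (n + 1) → ℝ :=
  Fin.snoc x ((∑ k, (partialSum b k : ℝ)) - ∑ i, x i)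

/-- The lifted `b`-parking-function polytope in `ℝⁿ⁺¹`. -/
def liftedParkingPolytope {n : ℕ} (b : Fin n → ℕ) : Set (Fin (n + 1) → ℝ) :=
  liftMap b '' parkingPolytope b

/-- The coordinate simplex `Δ_I = conv {e_i : i ∈ I}`. -/
def coordSimplex {m : ℕ} (I : Finset (Fin m)) : Set (Fin m → ℝ) :=
  convexHull ℝ ((fun i => (Pi.single i (1 : ℝ) : Fin m → ℝ)) '' (I : Set (Fin m)))

/-- `P` is the signed Minkowski sum `∑ y_I Δ_I` over the nonempty subsets `I` of the index set:
moving the summands with negative coefficients to the other side, the Minkowski sum of `P` and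
of the `(-y_I) Δ_I` with `y_I < 0` equals the Minkowski sum of the `y_I Δ_I` with `y_I > 0`.
(This is the usual Minkowski difference, `P = Q - R` iff `P + R = Q`; by the cancellation law it
determines `P` among compact convex sets. Summands with coefficient `0` contribute `{0}`.) -/
def IsSignedSimplexSum {m : ℕ} (P : Set (Fin m → ℝ)) (y : Finset (Fin m) → ℝ) : Prop :=
  P + ∑ I : Finset (Fin m) with I.Nonempty ∧ y I < 0, (-y I) • coordSimplex I =
    ∑ I : Finset (Fin m) with I.Nonempty ∧ 0 < y I, y I • coordSimplex I

/-- The 1-based entry `b_k`, for `1 ≤ k ≤ n` (and `0` outside this range, which is not used). -/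
def entry {n : ℕ} (b : Fin n → ℕ) (k : ℕ) : ℝ :=
  if h : 1 ≤ k ∧ k ≤ n then (b ⟨k - 1, by omega⟩ : ℝ) else 0

/-- The coefficients `y_I`, for nonempty `I ⊆ [n+1]`; the element `n + 1` is `Fin.last n`. -/
noncomputable def yCoeff {n : ℕ} (b : Fin n → ℕ) (I : Finset (Fin (n + 1))) : ℝ :=
  if Fin.last n ∈ I then
    if I.card = 1 then 0
    else if I.card = 2 then entry b 1 - 1
    else ∑ j ∈ Finset.range (I.card - 2),
      (-1 : ℝ) ^ (I.card + j - 1) * ((I.card - 3).choose j : ℝ) * entry b (j + 2)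
  else if I.card = 1 then 1
  else 0

/-! By Hahn–Banach a compact convex set is determined by its support function, which is additive
under Minkowski sums. The support function of a coordinate simplex is the maximum of the weights `w
i = φ (e_i)` over `I`, so it suffices to show that the lifted polytope has support function `∑ y_I
max_I w` (`isSignedSimplexSum_of_isGreatest`).

With `u_i = w_i - w_{n+1}`, the rearrangement inequality gives the maximum of `∑ u_i β_i` over
parking functions: `∑ u_i + ∑ max(0, u_(i)) (S_i - 1)`, where `u_(1) ≤ … ≤ u_(n)`
(`isGreatest_sum_mul_parkingFunction`).

On the simplex side, the sets containing `n + 1` are grouped by their other element of greatest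
weight. For `|I| = m + 2`, `y_I` is the `m`-th forward difference at `0` of `S_1 - 1, S_2 - 1, …`,
so Newton's formula collapses the group at rank `i` to `(S_i - 1) max(w_{n+1}, w_(i))`
(`sum_yCoeff_insert_last`). -/

section Support

/-! ### Support functions and Minkowski sums. -/

variable {E F : Type*} [AddCommGroup E] [Module ℝ E] [AddCommGroup F] [Module ℝ F]

theorem isGreatest_image_convexHull (φ : E →ₗ[ℝ] ℝ) {s : Set E} {c : ℝ}
    (h : IsGreatest (φ '' s) c) : IsGreatest (φ '' convexHull ℝ s) c := by
  refine ⟨Set.image_mono (subset_convexHull ℝ s) h.1, ?_⟩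
  rintro _ ⟨x, hx, rfl⟩
  have hs : s ⊆ {x | φ x ≤ c} := fun y hy => h.2 ⟨y, hy, rfl⟩
  exact convexHull_min hs (convex_halfSpace_le φ.isLinear c) hx

theorem isGreatest_image_add (φ : E →ₗ[ℝ] ℝ) {s t : Set E} {c d : ℝ}
    (hs : IsGreatest (φ '' s) c) (ht : IsGreatest (φ '' t) d) :
    IsGreatest (φ '' (s + t)) (c + d) := by
  rw [Set.image_add]
  refine ⟨Set.add_mem_add hs.1 ht.1, ?_⟩
  rintro _ ⟨x, hx, y, hy, rfl⟩
  exact add_le_add (hs.2 hx) (ht.2 hy)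

theorem isGreatest_image_smul (φ : E →ₗ[ℝ] ℝ) {s : Set E} {c r : ℝ} (hr : 0 ≤ r)
    (hs : IsGreatest (φ '' s) c) : IsGreatest (φ '' (r • s)) (r * c) := by
  constructor
  · obtain ⟨x, hx, rfl⟩ := hs.1
    exact ⟨r • x, Set.smul_mem_smul_set hx, by simp⟩
  · rintro _ ⟨_, ⟨x, hx, rfl⟩, rfl⟩
    simpa using mul_le_mul_of_nonneg_left (hs.2 ⟨x, hx, rfl⟩) hr

theorem isGreatest_image_sum (φ : E →ₗ[ℝ] ℝ) {ι : Type*} (T : Finset ι) (s : ι → Set E)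
    (c : ι → ℝ) (h : ∀ i ∈ T, IsGreatest (φ '' s i) (c i)) :
    IsGreatest (φ '' ∑ i ∈ T, s i) (∑ i ∈ T, c i) := by
  classical
  induction T using Finset.induction_on with
  | empty => simp [Set.image_zero]
  | insert a T ha ih =>
    rw [Finset.sum_insert ha, Finset.sum_insert ha]
    exact isGreatest_image_add φ (h a (Finset.mem_insert_self a T))
      (ih fun i hi => h i (Finset.mem_insert_of_mem hi))

theorem convex_compact_sum [TopologicalSpace E] [ContinuousAdd E]
    {ι : Type*} (T : Finset ι) (s : ι → Set E)
    (h : ∀ i ∈ T, Convex ℝ (s i) ∧ IsCompact (s i)) :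
    Convex ℝ (∑ i ∈ T, s i) ∧ IsCompact (∑ i ∈ T, s i) := by
  refine Finset.sum_induction s (fun s => Convex ℝ s ∧ IsCompact s) ?_ ?_ h
  · exact fun s t hs ht => ⟨hs.1.add ht.1, hs.2.add ht.2⟩
  · exact ⟨convex_singleton (𝕜 := ℝ) (0 : E), isCompact_singleton⟩

end Support

/-- A point of `s` outside `t` would be strictly separated from `t` by a functional whose maximum on
`s` then exceeds that on `t`. -/
theorem subset_of_isGreatest_image {E : Type*} [NormedAddCommGroup E] [NormedSpace ℝ E]
    {s t : Set E} (ht : Convex ℝ t) (htc : IsClosed t)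
    (h : ∀ φ : E →L[ℝ] ℝ, ∃ c, IsGreatest (φ '' s) c ∧ IsGreatest (φ '' t) c) : s ⊆ t := by
  intro x hx
  by_contra hxt
  obtain ⟨f, u, hu, hf⟩ := geometric_hahn_banach_closed_point ht htc hxt
  obtain ⟨c, hs, ht⟩ := h f
  obtain ⟨y, hy, rfl⟩ := ht.1
  have := hs.2 ⟨x, hx, rfl⟩
  linarith [hu y hy]

theorem convex_compact_coordSimplex {m : ℕ} (I : Finset (Fin m)) :
    Convex ℝ (coordSimplex I) ∧ IsCompact (coordSimplex I) :=
  ⟨convex_convexHull ℝ _, (I.finite_toSet.image _).isCompact_convexHull ℝ⟩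

theorem isGreatest_image_coordSimplex {m : ℕ} (φ : (Fin m → ℝ) →ₗ[ℝ] ℝ) {I : Finset (Fin m)}
    (hI : I.Nonempty) : IsGreatest (φ '' coordSimplex I)
      (sSup ((fun i => φ (Pi.single i 1)) '' (I : Set (Fin m)))) := by
  apply isGreatest_image_convexHull
  rw [Set.image_image]
  have hfin := I.finite_toSet.image (fun i => φ (Pi.single i 1))
  have hne : ((fun i => φ (Pi.single i 1)) '' (I : Set (Fin m))).Nonempty := hI.to_set.image _
  exact ⟨hne.csSup_mem hfin, fun x hx => le_csSup hfin.bddAbove hx⟩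

/-- A compact convex set is the signed sum of simplices with coefficients `y` as soon as its
support function is the corresponding combination of the support functions of the simplices. -/
theorem isSignedSimplexSum_of_isGreatest {m : ℕ} {P : Set (Fin m → ℝ)} {y : Finset (Fin m) → ℝ}
    (hP : Convex ℝ P) (hPc : IsCompact P)
    (h : ∀ φ : (Fin m → ℝ) →ₗ[ℝ] ℝ, IsGreatest (φ '' P)
      (∑ I, y I * sSup ((fun i => φ (Pi.single i 1)) '' (I : Set (Fin m))))) :
    IsSignedSimplexSum P y := by
  unfold IsSignedSimplexSum
  have hN := convex_compact_sum ({I : Finset (Fin m) | I.Nonempty ∧ y I < 0})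
    (fun I => (-y I) • coordSimplex I) fun I _ =>
      ⟨(convex_compact_coordSimplex I).1.smul _, (convex_compact_coordSimplex I).2.smul _⟩
  have hQ := convex_compact_sum ({I : Finset (Fin m) | I.Nonempty ∧ 0 < y I})
    (fun I => y I • coordSimplex I) fun I _ =>
      ⟨(convex_compact_coordSimplex I).1.smul _, (convex_compact_coordSimplex I).2.smul _⟩
  have key : ∀ φ : (Fin m → ℝ) →L[ℝ] ℝ, ∃ c,
      IsGreatest (φ '' (P + ∑ I : Finset (Fin m) with I.Nonempty ∧ y I < 0,
        (-y I) • coordSimplex I)) c ∧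
      IsGreatest (φ '' (∑ I : Finset (Fin m) with I.Nonempty ∧ 0 < y I,
        y I • coordSimplex I)) c := by
    intro φ
    have h₁ := isGreatest_image_add φ.toLinearMap (h φ.toLinearMap)
      (isGreatest_image_sum φ.toLinearMap ({I : Finset (Fin m) | I.Nonempty ∧ y I < 0})
        (fun I => (-y I) • coordSimplex I) _ fun I hI => by
          have hI := (Finset.mem_filter.1 hI).2
          exact isGreatest_image_smul _ (by linarith) (isGreatest_image_coordSimplex _ hI.1))
    have h₂ := isGreatest_image_sum φ.toLinearMap ({I : Finset (Fin m) | I.Nonempty ∧ 0 < y I})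
        (fun I => y I • coordSimplex I) _ fun I hI => by
          have hI := (Finset.mem_filter.1 hI).2
          exact isGreatest_image_smul _ hI.2.le (isGreatest_image_coordSimplex _ hI.1)
    refine ⟨_, h₁, ?_⟩
    suffices e : ∑ I, y I * sSup ((fun i => φ (Pi.single i 1)) '' (I : Set (Fin m))) +
        ∑ I : Finset (Fin m) with I.Nonempty ∧ y I < 0,
          -y I * sSup ((fun i => φ (Pi.single i 1)) '' (I : Set (Fin m))) =
        ∑ I : Finset (Fin m) with I.Nonempty ∧ 0 < y I,
          y I * sSup ((fun i => φ (Pi.single i 1)) '' (I : Set (Fin m))) from e ▸ h₂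
    rw [Finset.sum_filter, Finset.sum_filter, ← Finset.sum_add_distrib]
    refine Finset.sum_congr rfl fun I _ => ?_
    -- The empty set contributes nothing to the full sum, whatever `y ∅` is, since `sSup ∅ = 0` in
    -- `ℝ`.
    rcases I.eq_empty_or_nonempty with rfl | hI
    · simp
    · rcases lt_trichotomy (y I) 0 with hy | hy | hy
      · simp [hI, hy, hy.le]
      · simp [hy]
      · simp [hI, hy, hy.le]
  refine Set.Subset.antisymm (subset_of_isGreatest_image hQ.1 hQ.2.isClosed key)
    (subset_of_isGreatest_image (hP.add hN.1) (hPc.add hN.2).isClosed fun φ => ?_)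
  obtain ⟨c, h₁, h₂⟩ := key φ
  exact ⟨c, h₂, h₁⟩

/-! ### Subsets by largest element, and coefficients as finite differences. -/

section Combinatorics

/-- Grouping the nonempty subsets of a finite linear order by their largest element. -/
theorem sum_nonempty_eq_sum_insert {α M : Type*} [Fintype α] [LinearOrder α]
    [LocallyFiniteOrderBot α] [AddCommMonoid M] (f : Finset α → M) :
    ∑ J : Finset α with J.Nonempty, f J =
      ∑ i, ∑ K ∈ (Finset.Iio i).powerset, f (insert i K) := by
  rw [Finset.sum_sigma']
  symm
  refine Finset.sum_bij (fun p _ => insert p.1 p.2) ?_ ?_ ?_ ?_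
  · simp
  · rintro ⟨i, K⟩ hK ⟨j, L⟩ hL h
    simp only [Finset.mem_sigma, Finset.mem_univ, Finset.mem_powerset, true_and] at hK hL h
    have hK' : ∀ x ∈ K, x < i := fun x hx => Finset.mem_Iio.1 (hK hx)
    have hL' : ∀ x ∈ L, x < j := fun x hx => Finset.mem_Iio.1 (hL hx)
    have hij : i = j := by
      have h₁ : i ∈ insert j L := h ▸ Finset.mem_insert_self i K
      have h₂ : j ∈ insert i K := h ▸ Finset.mem_insert_self j L
      rcases Finset.mem_insert.1 h₁ with e | e
      · exact e
      rcases Finset.mem_insert.1 h₂ with e' | e'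
      · exact e'.symm
      exact absurd (hL' _ e) (hK' _ e').not_gt
    subst hij
    have : K = L := by
      rw [← Finset.erase_insert (fun hx => (hK' _ hx).false),
        ← Finset.erase_insert (a := i) (s := L) (fun hx => (hL' _ hx).false), h]
    rw [this]
  · intro J hJ
    have hJ := (Finset.mem_filter.1 hJ).2
    refine ⟨⟨J.max' hJ, J.erase (J.max' hJ)⟩, ?_, Finset.insert_erase (J.max'_mem hJ)⟩
    simp only [Finset.mem_sigma, Finset.mem_univ, Finset.mem_powerset, true_and]
    exact fun x hx => Finset.mem_Iio.2 (J.lt_max'_of_mem_erase_max' hJ hx)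
  · simp

variable {n : ℕ}

/-- The sequence `i ↦ b_1 + ⋯ + b_{i+1} - 1`. -/
def entrySum (b : Fin n → ℕ) (i : ℕ) : ℝ :=
  ∑ t ∈ Finset.range (i + 1), entry b (t + 1) - 1

theorem entrySum_eq (b : Fin n → ℕ) (i : Fin n) : entrySum b i = partialSum b i - 1 := by
  have h : ∀ j : Fin n, (b j : ℝ) = entry b (j + 1) := fun j => by
    simp [entry, j.2]
  rw [entrySum, partialSum, Nat.cast_sum, Finset.sum_congr rfl fun j _ => h j]
  congr 1
  have : Finset.range (i + 1) = (Finset.Iic i).map Fin.valEmbedding := by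
    rw [Fin.map_valEmbedding_Iic]
    ext; simp
  rw [this, Finset.sum_map]
  rfl

/-- The first difference of `entrySum b` is `i ↦ b_{i+2}`; differencing it `|I| - 3` more times
yields the alternating binomial sum. -/
theorem yCoeff_of_last_mem (b : Fin n → ℕ) {I : Finset (Fin (n + 1))} {m : ℕ}
    (hl : Fin.last n ∈ I) (hI : I.card = m + 2) :
    yCoeff b I = (fwdDiff 1)^[m] (entrySum b) 0 := by
  rcases m with _ | m
  · simp [yCoeff, hl, hI, entrySum]
  · have hd : fwdDiff 1 (entrySum b) = fun i => entry b (i + 2) := by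
      ext i
      simp only [fwdDiff, entrySum]
      rw [Finset.sum_range_succ _ (i + 1)]
      ring
    rw [Function.iterate_succ_apply, hd, fwdDiff_iter_eq_sum_shift]
    simp only [yCoeff, hl, hI, if_true]
    rw [if_neg (by omega), if_neg (by omega)]
    refine Finset.sum_congr (by simp) fun j hj => ?_
    have hj : j ≤ m := by simp at hj; omega
    -- The two sign exponents differ by an even number.
    have e : m + 1 + 2 + j - 1 = (m - j) + 2 * (j + 1) := by omega
    rw [e, pow_add, pow_mul]
    simp [zsmul_eq_mul]

theorem sum_choose_fwdDiff (b : Fin n → ℕ) (i : ℕ) :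
    ∑ m ∈ Finset.range (i + 1), (i.choose m : ℝ) * (fwdDiff 1)^[m] (entrySum b) 0 =
      entrySum b i := by
  simpa [nsmul_eq_mul] using (shift_eq_sum_fwdDiff_iter 1 (entrySum b) i 0).symm

end Combinatorics
-- The support function of the lifted polytope.
section Parking

variable {n : ℕ} (b : Fin n → ℕ)

theorem partialSum_mono : Monotone (partialSum b) := fun _ _ h =>
  Finset.sum_le_sum_of_subset (Finset.Iic_subset_Iic.2 h)

theorem finite_setOf_isParkingFunction : {β : Fin n → ℕ | IsParkingFunction b β}.Finite := by
  refine (Set.finite_Icc 0 fun _ => ∑ j, b j).subset fun β hβ =>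
    ⟨fun _ => Nat.zero_le _, fun j => ?_⟩
  have := hβ.2 ((Tuple.sort β).symm j)
  simp only [Function.comp_apply, Equiv.apply_symm_apply] at this
  exact this.trans (Finset.sum_le_sum_of_subset (Finset.subset_univ _))

/-- Any sorting permutation may replace `Tuple.sort β`, since the sorted sequence is unique. -/
theorem isParkingFunction_of_comp_perm {β : Fin n → ℕ} (hβ : ∀ i, 0 < β i)
    (σ : Equiv.Perm (Fin n)) (hm : Monotone (β ∘ σ)) (hS : ∀ i, β (σ i) ≤ partialSum b i) :
    IsParkingFunction b β := by
  refine ⟨hβ, fun i => ?_⟩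
  rw [← Tuple.comp_sort_eq_comp_iff_monotone.2 hm]
  exact hS i

/-- The linear part of `liftMap`. -/
def liftLinear (n : ℕ) : (Fin n → ℝ) →ₗ[ℝ] (Fin (n + 1) → ℝ) where
  toFun x := Fin.snoc x (-∑ i, x i)
  map_add' x y := by
    ext i
    refine Fin.lastCases ?_ (fun i => ?_) i
    · simp [Finset.sum_add_distrib]; ring
    · simp
  map_smul' r x := by
    ext i
    refine Fin.lastCases ?_ (fun i => ?_) i
    · simp [Finset.mul_sum]
    · simp

theorem liftedParkingPolytope_eq_convexHull : liftedParkingPolytope b =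
    convexHull ℝ ((fun β : Fin n → ℕ => liftMap b fun i => (β i : ℝ)) ''
      {β | IsParkingFunction b β}) := by
  have h : liftMap b = ⇑((liftLinear n).toAffineMap +
      AffineMap.const ℝ (Fin n → ℝ) (Pi.single (Fin.last n) (∑ k, (partialSum b k : ℝ)) : Fin (n + 1) → ℝ)) := by
    ext x i
    refine Fin.lastCases ?_ (fun i => ?_) i
    · simp [liftMap, liftLinear]; ring
    · simp [liftMap, liftLinear]
  rw [liftedParkingPolytope, parkingPolytope, h, AffineMap.image_convexHull, Set.image_image]

theorem convex_compact_liftedParkingPolytope :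
    Convex ℝ (liftedParkingPolytope b) ∧ IsCompact (liftedParkingPolytope b) := by
  rw [liftedParkingPolytope_eq_convexHull]
  exact ⟨convex_convexHull ℝ _,
    ((finite_setOf_isParkingFunction b).image _).isCompact_convexHull ℝ⟩

theorem apply_liftMap (φ : (Fin (n + 1) → ℝ) →ₗ[ℝ] ℝ) (x : Fin n → ℝ) :
    φ (liftMap b x) = φ (Pi.single (Fin.last n) 1) * ∑ k, (partialSum b k : ℝ) +
      ∑ i, (φ (Pi.single (Fin.castSucc i) 1) - φ (Pi.single (Fin.last n) 1)) * x i := by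
  have h : ∀ z, φ z = ∑ i, z i * φ (Pi.single i 1) := fun z => by
    conv_lhs => rw [pi_eq_sum_univ' z]
    simp [map_sum]
  rw [h, Fin.sum_univ_castSucc]
  simp only [liftMap, Fin.snoc_castSucc, Fin.snoc_last, sub_mul, Finset.sum_sub_distrib,
    ← Finset.mul_sum]
  simp only [mul_comm (x _)]
  ring

/-- Maximum of a linear functional over all parking functions. -/
theorem isGreatest_sum_mul_parkingFunction (hb : ∀ i, 0 < b i) (u : Fin n → ℝ) :
    IsGreatest ((fun β : Fin n → ℕ => ∑ i, u i * (β i : ℝ)) '' {β | IsParkingFunction b β})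
      (∑ i, u i + ∑ i, max 0 (u (Tuple.sort u i)) * ((partialSum b i : ℝ) - 1)) := by
  set σ := Tuple.sort u with hσ
  have hu : Monotone (u ∘ σ) := Tuple.monotone_sort u
  have hpos : ∀ i, 1 ≤ partialSum b i := fun i =>
    (hb i).trans_le (Finset.single_le_sum (fun _ _ => Nat.zero_le _) (Finset.mem_Iic.2 le_rfl))
  rw [← Equiv.sum_comp σ u, ← Finset.sum_add_distrib]
  constructor
  -- The maximizer takes the largest admissible value at its rank where the weight is nonnegative,
  -- and the least value `1` elsewhere. Negative weights come first under `σ`, so it is sorted by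
  -- `σ`.
  · refine ⟨fun j => if 0 ≤ u j then partialSum b (σ.symm j) else 1, ?_, ?_⟩
    · refine isParkingFunction_of_comp_perm b (fun j => ?_) σ (fun i j hij => ?_) fun i => ?_
      · split_ifs
        · exact hpos _
        · exact one_pos
      · have h : u (σ i) ≤ u (σ j) := hu hij
        simp only [Function.comp_apply, Equiv.symm_apply_apply]
        split_ifs with h₁ h₂
        · exact partialSum_mono b hij
        · exact absurd (h₁.trans h) h₂
        · exact hpos _
        · exact le_rfl
      · simp only [Equiv.symm_apply_apply]
        split_ifs
        · exact le_rfl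
        · exact hpos _
    · dsimp only
      rw [← Equiv.sum_comp σ]
      refine Finset.sum_congr rfl fun i _ => ?_
      rw [Equiv.symm_apply_apply]
      split_ifs with h
      · rw [max_eq_right h]; ring
      · rw [max_eq_left (not_le.1 h).le]; simp
  · rintro _ ⟨β, hβ, rfl⟩
    dsimp only
    have hv : Monotone fun i => max 0 (u (σ i)) := fun i j hij => max_le_max le_rfl (hu hij)
    have h₁ : ∑ i, max 0 (u (σ i)) * (β (σ i) : ℝ) ≤
        ∑ i, max 0 (u (σ i)) * (β (Tuple.sort β i) : ℝ) := by
      have hm : Monotone fun i => (β (Tuple.sort β i) : ℝ) := fun i j hij =>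
        Nat.cast_le.2 (Tuple.monotone_sort β hij)
      have := (hv.monovary hm).sum_mul_comp_perm_le_sum_mul (σ := (Tuple.sort β)⁻¹ * σ)
      simpa using this
    have h₂ : ∑ i, max 0 (u (σ i)) * (β (Tuple.sort β i) : ℝ) ≤
        ∑ i, max 0 (u (σ i)) * (partialSum b i : ℝ) :=
      Finset.sum_le_sum fun i _ =>
        mul_le_mul_of_nonneg_left (Nat.cast_le.2 (hβ.2 i)) (le_max_left _ _)
    have h₃ : ∑ i, u (σ i) * (β (σ i) : ℝ) ≤
        ∑ i, (u (σ i) - max 0 (u (σ i)) + max 0 (u (σ i)) * (β (σ i) : ℝ)) := by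
      refine Finset.sum_le_sum fun i _ => ?_
      have h1 : (1 : ℝ) ≤ β (σ i) := by exact_mod_cast hβ.1 (σ i)
      -- This is `(u - max 0 u) * (β - 1) ≤ 0`.
      nlinarith [le_max_right 0 (u (σ i))]
    rw [← Equiv.sum_comp σ]
    simp only [Finset.sum_add_distrib, Finset.sum_sub_distrib, mul_sub, mul_one] at h₃ ⊢
    linarith

theorem isGreatest_image_liftedParkingPolytope (hb : ∀ i, 0 < b i)
    (φ : (Fin (n + 1) → ℝ) →ₗ[ℝ] ℝ) {u : Fin n → ℝ}
    (hu : ∀ i, u i = φ (Pi.single (Fin.castSucc i) 1) - φ (Pi.single (Fin.last n) 1)) :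
    IsGreatest (φ '' liftedParkingPolytope b)
      (φ (Pi.single (Fin.last n) 1) * ∑ k, (partialSum b k : ℝ) +
        (∑ i, u i + ∑ i, max 0 (u (Tuple.sort u i)) * ((partialSum b i : ℝ) - 1))) := by
  rw [liftedParkingPolytope_eq_convexHull]
  apply isGreatest_image_convexHull
  obtain ⟨⟨β, hβ, h⟩, hle⟩ := isGreatest_sum_mul_parkingFunction b hb u
  rw [Set.image_image]
  simp only [apply_liftMap, ← hu]
  refine ⟨⟨β, hβ, by rw [← h]⟩, ?_⟩
  rintro _ ⟨γ, hγ, rfl⟩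
  exact add_le_add le_rfl (hle ⟨γ, hγ, rfl⟩)

end Parking

/-! ### The support function of the signed simplex sum. -/

section SimplexSum

variable {n : ℕ} (b : Fin n → ℕ)

/-- Splitting a sum over subsets of `Fin (n + 1)` according to membership of the last element. -/
theorem sum_finset_fin_succ {M : Type*} [AddCommMonoid M] (f : Finset (Fin (n + 1)) → M) :
    ∑ I, f I = ∑ J : Finset (Fin n), f (J.map Fin.castSuccEmb) +
      ∑ J : Finset (Fin n), f (insert (Fin.last n) (J.map Fin.castSuccEmb)) := by
  have hu : (Finset.univ : Finset (Fin (n + 1))) =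
      insert (Fin.last n) (Finset.univ.map Fin.castSuccEmb) := by
    ext i
    refine Fin.lastCases ?_ (fun i => ?_) i <;> simp
  have hm : ∀ g : Finset (Fin (n + 1)) → M,
      ∑ I ∈ (Finset.univ.map (Fin.castSuccEmb (n := n))).powerset, g I =
      ∑ J : Finset (Fin n), g (J.map Fin.castSuccEmb) := fun g => by
    symm
    refine Finset.sum_bij (fun J _ => J.map Fin.castSuccEmb) ?_ ?_ ?_ ?_
    · intro J _
      exact Finset.mem_powerset.2 (Finset.map_subset_map.2 (Finset.subset_univ J))
    · intro J _ K _ h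
      exact Finset.map_injective _ h
    · intro I hI
      obtain ⟨J, -, rfl⟩ := Finset.subset_map_iff.1 (Finset.mem_powerset.1 hI)
      exact ⟨J, Finset.mem_univ _, rfl⟩
    · simp
  rw [← Finset.powerset_univ, hu, Finset.sum_powerset_insert (by simp), hm, hm]

theorem sum_yCoeff_map_castSucc (w : Fin (n + 1) → ℝ) :
    ∑ J : Finset (Fin n), yCoeff b (J.map Fin.castSuccEmb) *
      sSup (w '' (J.map Fin.castSuccEmb : Finset (Fin (n + 1)))) = ∑ i : Fin n, w i.castSucc := by
  symm
  refine Finset.sum_of_injOn (fun i => {i}) ?_ ?_ ?_ ?_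
  · exact Finset.singleton_injective.injOn
  · simp
  · intro J _ hJ
    have : J.card ≠ 1 := fun h => hJ (by
      obtain ⟨a, rfl⟩ := Finset.card_eq_one.1 h
      simp)
    simp [yCoeff, this]
  · intro i _
    simp [yCoeff, (Fin.castSucc_ne_last i).symm]

theorem sum_yCoeff_insert_last (w : Fin (n + 1) → ℝ) (σ : Equiv.Perm (Fin n))
    (hσ : Monotone fun i => w (σ i).castSucc) :
    ∑ J : Finset (Fin n), yCoeff b (insert (Fin.last n) (J.map Fin.castSuccEmb)) *
      sSup (w '' (insert (Fin.last n) (J.map Fin.castSuccEmb) : Finset (Fin (n + 1)))) =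
      ∑ i, max (w (Fin.last n)) (w (σ i).castSucc) * ((partialSum b i : ℝ) - 1) := by
  set f : Finset (Fin n) → ℝ := fun J =>
    yCoeff b (insert (Fin.last n) (J.map Fin.castSuccEmb)) *
      sSup (w '' (insert (Fin.last n) (J.map Fin.castSuccEmb) : Finset (Fin (n + 1)))) with hf
  have h0 : f ∅ = 0 := by simp [hf, yCoeff]
  have h1 : ∑ J, f J = ∑ J : Finset (Fin n) with J.Nonempty, f (J.map σ.toEmbedding) := by
    rw [← Equiv.sum_comp σ.finsetCongr f, Finset.sum_filter]
    refine Finset.sum_congr rfl fun J _ => ?_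
    rcases J.eq_empty_or_nonempty with rfl | hJ
    · simp [h0]
    · simp [hJ]
  rw [h1, sum_nonempty_eq_sum_insert]
  refine Finset.sum_congr rfl fun i _ => ?_
  -- After relabelling by `σ`, the index `i` carries the greatest weight in `insert i K`, so the
  -- maximum does not depend on `K`, and the coefficient depends only on `K.card`.
  have h2 : ∀ K ∈ (Finset.Iio i).powerset, f ((insert i K).map σ.toEmbedding) =
      (fwdDiff 1)^[K.card] (entrySum b) 0 * max (w (Fin.last n)) (w (σ i).castSucc) := by
    intro K hK
    have hK : ∀ x ∈ K, x < i := fun x hx => Finset.mem_Iio.1 (Finset.mem_powerset.1 hK hx)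
    have hi : i ∉ K := fun h => (hK i h).false
    simp only [hf]
    rw [yCoeff_of_last_mem b (m := K.card) (Finset.mem_insert_self _ _)]
    · congr 1
      refine IsGreatest.csSup_eq ⟨?_, ?_⟩
      · rcases max_choice (w (Fin.last n)) (w (σ i).castSucc) with h | h <;> rw [h]
        · exact ⟨Fin.last n, by simp, rfl⟩
        · exact ⟨(σ i).castSucc, by simp, rfl⟩
      · rintro _ ⟨x, hx, rfl⟩
        simp only [Finset.coe_insert, Finset.coe_map, Set.mem_insert_iff, Set.mem_image,
          Finset.mem_coe] at hx
        rcases hx with rfl | ⟨_, ⟨y, hy, rfl⟩, rfl⟩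
        · exact le_max_left _ _
        · have hy : y ≤ i := by
            rcases hy with rfl | hy
            · exact le_rfl
            · exact (hK y hy).le
          exact (hσ hy).trans (le_max_right _ _)
    · rw [Finset.card_insert_of_notMem (by simp [(Fin.castSucc_ne_last _).symm]), Finset.card_map, Finset.card_map,
        Finset.card_insert_of_notMem hi]
  rw [Finset.sum_congr rfl h2, ← Finset.sum_mul,
    Finset.sum_powerset_apply_card fun m => (fwdDiff 1)^[m] (entrySum b) 0]
  simp only [nsmul_eq_mul, Fin.card_Iio]
  rw [sum_choose_fwdDiff, entrySum_eq, mul_comm]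

end SimplexSum

theorem mainTheorem4 (n : ℕ) (hn : 0 < n) (b : Fin n → ℕ) (hb : ∀ i, 0 < b i) :
    IsSignedSimplexSum (liftedParkingPolytope b) (yCoeff b) := by
  obtain ⟨hc, hk⟩ := convex_compact_liftedParkingPolytope b
  refine isSignedSimplexSum_of_isGreatest hc hk fun φ => ?_
  set w : Fin (n + 1) → ℝ := fun i => φ (Pi.single i 1) with hw
  set u : Fin n → ℝ := fun i => w i.castSucc - w (Fin.last n) with hu
  have hσ : Monotone fun i => w (Tuple.sort u i).castSucc := fun i j hij => by
    have : u (Tuple.sort u i) ≤ u (Tuple.sort u j) := Tuple.monotone_sort u hij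
    simpa [hu] using this
  have key := isGreatest_image_liftedParkingPolytope b hb φ (u := u) fun _ => rfl
  rw [sum_finset_fin_succ, sum_yCoeff_map_castSucc, sum_yCoeff_insert_last b w _ hσ]
  convert key using 1
  -- The terms in `w_{n+1}` amount to `(B - n) w_{n+1}` on both sides; on the polytope side the `-n`
  -- comes from `∑ u_i`.
  have hmax : ∀ i, max (w (Fin.last n)) (w (Tuple.sort u i).castSucc) =
      w (Fin.last n) + max 0 (u (Tuple.sort u i)) := fun i => by
    rw [← max_add_add_left]
    simp [hu]
  simp only [hmax, add_mul, Finset.sum_add_distrib, ← Finset.mul_sum, Finset.sum_sub_distrib]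
  simp [hu, Finset.sum_sub_distrib]
  ring
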